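/- Theorem (non-compactness). Let $d\ge 1$, let $\mu$ be a bounded (complex Borel) measure on $\mathbb{R}^{2d}$ and let $\varphi\in M^1(\mathbb{R}^d)$, i.e. $\varphi\in L^2(\mathbb{R}^d)$ and $V_g\varphi\in L^1(\mathbb{R}^{2d})$ for some nonzero Schwartz function $g$ on $\mathbb{R}^d$. Here $$V_\varphi\psi(x,\omega)=\int_{\mathbb{R}^d}\psi(t)\,\overline{\varphi(t-x)}\,e^{-2\pi i\,\omega\cdot t}\,dt\qquad(x,\omega\in\mathbb{R}^d)$$ is the short-time Fourier transform of $\psi$ with window $\varphi$. It defines a bounded operator $V_\varphi:L^2(\mathbb{R}^d)\to L^2(\mathbb{R}^{2d})$, whose adjoint is denoted by $V_\varphi^*$. Let $$B_\mu^\varphi:L^2(\mathbb{R}^d)\to L^2(\mathbb{R}^d),\qquad B_\mu^\varphi\psi=V_\varphi^*\bigl(\mu*V_\varphi\psi\bigr),\qquad (\mu*F)(z)=\int_{\mathbb{R}^{2d}}F(z-w)\,d\mu(w),$$ be the time-frequency blurring operator, which is a bounded linear operator. If $B_\mu^\varphi$ is not the zero operator, then $B_\mu^\varphi$ is not compact on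 $L^2(\mathbb{R}^d)$. -/

import Mathlib

open MeasureTheory FourierTransform SchwartzMap
open scoped ENNReal ComplexConjugate RealInnerProductSpace

noncomputable section

namespace TimeFrequency

/-- `ℝᵈ` with its Euclidean structure. -/
abbrev Space (d : ℕ) : Type := EuclideanSpace ℝ (Fin d)

/-- Phase space `ℝ²ᵈ = ℝᵈ × ℝᵈ`; its points are written `z = (x, ω)`, and `volume` on it is the
product Lebesgue measure. -/
abbrev PhaseSpace (d : ℕ) : Type := Space d × Space d

/-- Complex-valued `L²` with respect to Lebesgue measure. -/
abbrev L2 (α : Type) [MeasureSpace α] : Type := Lp ℂ 2 (volume : Measure α)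

variable {d : ℕ}

/-- The short-time Fourier transform
`V_φ ψ (x, ω) = ∫ ψ(t) conj(φ(t - x)) e^{-2π i ω · t} dt` of `ψ` with window `φ`. -/
def stft (φ ψ : Space d → ℂ) (z : PhaseSpace d) : ℂ :=
  ∫ t : Space d, ψ t * conj (φ (t - z.1)) *
    Complex.exp (-(2 * Real.pi * Complex.I * ((⟪z.2, t⟫ : ℝ) : ℂ)))

/-! ### The short-time Fourier transform on `L²` -/

lemma stft_eq_fourier (φ ψ : Space d → ℂ) (x ω : Space d) :
    stft φ ψ (x, ω) = 𝓕 (fun t ↦ ψ t * conj (φ (t - x))) ω := by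
  rw [stft, Real.fourier_eq]
  refine integral_congr_ae (.of_forall fun t ↦ ?_)
  simp only [Circle.smul_def, Real.fourierChar_apply, smul_eq_mul]
  rw [mul_comm, real_inner_comm]
  congr 2
  push_cast
  ring

/-- The translate `t ↦ φ(t - x)` as an element of `L²`. -/
def translate (φ : L2 (Space d)) (x : Space d) : L2 (Space d) :=
  Lp.compMeasurePreserving (fun t ↦ t - x) (measurePreserving_sub_right volume x) φ

lemma coeFn_translate (φ : L2 (Space d)) (x : Space d) :
    translate φ x =ᵐ[volume] fun t ↦ φ (t - x) :=
  Lp.coeFn_compMeasurePreserving _ _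

lemma norm_translate (φ : L2 (Space d)) (x : Space d) : ‖translate φ x‖ = ‖φ‖ :=
  Lp.norm_compMeasurePreserving _ _

lemma continuous_translate (φ : L2 (Space d)) : Continuous (translate φ) := by
  let g : C(Space d, C(Space d, Space d)) :=
    (ContinuousMap.mk (fun a : Space d × Space d ↦ a.2 - a.1) (by fun_prop)).curry
  exact (continuous_const (y := φ)).compMeasurePreservingLp g.continuous
    (fun x ↦ measurePreserving_sub_right volume x) ENNReal.ofNat_ne_top

lemma norm_integral_mul_le (f g : L2 (Space d)) (u : Space d → ℂ) (hu : ∀ t, ‖u t‖ = 1) :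
    ‖∫ t, f t * conj (g t) * u t‖ ≤ ‖f‖ * ‖g‖ := by
  have key : ∀ h : L2 (Space d), (∫ t, ‖h t‖ ^ (2 : ℝ)) ^ (1 / (2 : ℝ)) = ‖h‖ := by
    intro h
    rw [Lp.norm_def, (Lp.memLp h).eLpNorm_eq_integral_rpow_norm (by simp) (by simp)]
    rw [ENNReal.toReal_ofReal (by positivity)]
    simp
  refine (norm_integral_le_integral_norm _).trans ?_
  simp only [norm_mul, hu, mul_one, RCLike.norm_conj]
  have := integral_mul_norm_le_Lp_mul_Lq (μ := (volume : Measure (Space d))) (f := f) (g := g)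
    (p := 2) (q := 2) Real.HolderConjugate.two_two (by simpa using Lp.memLp f)
    (by simpa using Lp.memLp g)
  rwa [key, key] at this

lemma norm_phase (ω t : Space d) :
    ‖Complex.exp (-(2 * Real.pi * Complex.I * ((⟪ω, t⟫ : ℝ) : ℂ)))‖ = 1 := by
  rw [Complex.norm_exp]
  simp

lemma integrable_stft (φ ψ : L2 (Space d)) (x : Space d) :
    Integrable (fun t ↦ ψ t * conj (φ (t - x))) := by
  have h : MemLp (fun t ↦ conj (φ (t - x))) 2 volume :=
    ((Lp.memLp φ).comp_measurePreserving (measurePreserving_sub_right volume x)).star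
  exact (Lp.memLp ψ).integrable_mul h

lemma integrable_stft' (φ ψ : L2 (Space d)) (z : PhaseSpace d) :
    Integrable (fun t ↦ ψ t * conj (φ (t - z.1)) *
      Complex.exp (-(2 * Real.pi * Complex.I * ((⟪z.2, t⟫ : ℝ) : ℂ)))) := by
  refine (integrable_stft φ ψ z.1).mul_bdd (c := 1) ?_ (.of_forall fun t ↦ (norm_phase _ _).le)
  exact Continuous.aestronglyMeasurable (by fun_prop)

lemma stft_eq_translate (φ ψ : L2 (Space d)) (z : PhaseSpace d) :
    stft φ ψ z = ∫ t, ψ t * conj (translate φ z.1 t) *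
      Complex.exp (-(2 * Real.pi * Complex.I * ((⟪z.2, t⟫ : ℝ) : ℂ))) := by
  refine integral_congr_ae ?_
  filter_upwards [coeFn_translate φ z.1] with t ht
  rw [ht]

lemma norm_stft_le (φ ψ : L2 (Space d)) (z : PhaseSpace d) : ‖stft φ ψ z‖ ≤ ‖φ‖ * ‖ψ‖ := by
  rw [stft_eq_translate]
  refine (norm_integral_mul_le _ _ _ (fun t ↦ norm_phase _ _)).trans ?_
  rw [norm_translate, mul_comm]

lemma norm_stft_sub_le (φ ψ : L2 (Space d)) (x y ω : Space d) :
    ‖stft φ ψ (x, ω) - stft φ ψ (y, ω)‖ ≤ ‖ψ‖ * ‖translate φ x - translate φ y‖ := by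
  refine le_of_eq_of_le ?_ (norm_integral_mul_le ψ (translate φ x - translate φ y) _
    (norm_phase ω))
  rw [stft, stft, ← integral_sub (integrable_stft' _ _ _) (integrable_stft' _ _ _)]
  congr 1
  refine integral_congr_ae ?_
  filter_upwards [coeFn_translate φ x, coeFn_translate φ y,
    Lp.coeFn_sub (translate φ x) (translate φ y)] with t h1 h2 h3
  rw [h3, Pi.sub_apply, h1, h2, map_sub]
  ring

lemma continuous_stft (φ ψ : L2 (Space d)) : Continuous (stft φ ψ) := by
  rw [continuous_iff_continuousAt]
  rintro ⟨x, ω⟩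
  have h1 : Filter.Tendsto (fun z : PhaseSpace d ↦ stft φ ψ z - stft φ ψ (x, z.2))
      (nhds (x, ω)) (nhds 0) := by
    have hc : Continuous fun z : PhaseSpace d ↦ ‖ψ‖ * ‖translate φ z.1 - translate φ x‖ :=
      continuous_const.mul
        (((continuous_translate φ).comp continuous_fst).sub continuous_const).norm
    have hc0 : Filter.Tendsto (fun z : PhaseSpace d ↦ ‖ψ‖ * ‖translate φ z.1 - translate φ x‖)
        (nhds (x, ω)) (nhds 0) := by
      have h := hc.tendsto (x, ω)
      rwa [sub_self, norm_zero, mul_zero] at h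
    refine squeeze_zero_norm (fun z ↦ ?_) hc0
    obtain ⟨y, η⟩ := z
    exact norm_stft_sub_le φ ψ y x η
  have h2 : Continuous fun z : PhaseSpace d ↦ stft φ ψ (x, z.2) := by
    refine continuous_of_dominated (fun z ↦ (integrable_stft' φ ψ (x, z.2)).1)
      (bound := fun t ↦ ‖ψ t * conj (φ (t - x))‖) (fun z ↦ .of_forall fun t ↦ ?_)
      (integrable_stft φ ψ x).norm (.of_forall fun t ↦ ?_)
    · rw [norm_mul, norm_phase, mul_one]
    · simp only
      exact continuous_const.mul (by fun_prop)
  have h3 := h1.add (h2.tendsto (x, ω))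
  rw [zero_add] at h3
  exact h3.congr fun z ↦ sub_add_cancel _ _

lemma stft_add (φ ψ₁ ψ₂ : L2 (Space d)) :
    stft φ ↑(ψ₁ + ψ₂) = stft φ ψ₁ + stft φ ψ₂ := by
  ext z
  rw [Pi.add_apply, stft, stft, stft,
    ← integral_add (integrable_stft' _ _ _) (integrable_stft' _ _ _)]
  refine integral_congr_ae ?_
  filter_upwards [Lp.coeFn_add ψ₁ ψ₂] with t ht
  rw [ht, Pi.add_apply]
  ring

lemma stft_smul (φ : L2 (Space d)) (c : ℂ) (ψ : L2 (Space d)) :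
    stft φ ↑(c • ψ) = c • stft φ ψ := by
  ext z
  rw [Pi.smul_apply, stft, stft, ← integral_smul]
  refine integral_congr_ae ?_
  filter_upwards [Lp.coeFn_smul c ψ] with t ht
  rw [ht, Pi.smul_apply, smul_eq_mul, smul_eq_mul]
  ring

/-- Plancherel's identity for the integral Fourier transform on `L¹ ∩ L²`. -/
lemma eLpNorm_fourier_eq {f : Space d → ℂ} (hf : Integrable f) (hf2 : MemLp f 2 volume) :
    eLpNorm (𝓕 f) 2 volume = eLpNorm f 2 volume := by
  set F : L2 (Space d) := hf2.toLp f with hF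
  have hcont : Continuous (𝓕 f) :=
    VectorFourier.fourierIntegral_continuous Real.continuous_fourierChar
      (by exact continuous_inner) hf
  have hae : (𝓕 F : L2 (Space d)) =ᵐ[volume] 𝓕 f := by
    refine ae_eq_of_integral_contDiff_smul_eq
      ((Lp.memLp _).locallyIntegrable (by norm_num)) hcont.locallyIntegrable ?_
    intro g g_smooth g_cpt
    have hg₁ : HasCompactSupport (Complex.ofRealCLM ∘ g) := g_cpt.comp_left rfl
    have hg₂ : ContDiff ℝ (⊤ : ℕ∞) (Complex.ofRealCLM ∘ g) := by fun_prop
    set G : 𝓢(Space d, ℂ) := hg₁.toSchwartzMap hg₂ with hG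
    have e1 := congrArg (fun T : 𝓢'(Space d, ℂ) ↦ T G) (Lp.fourier_toTemperedDistribution_eq F)
    simp only [TemperedDistribution.fourier_apply, Lp.toTemperedDistribution_apply] at e1
    have e2 : ∫ x, (𝓕 G) x • F x = ∫ x, (𝓕 (G : Space d → ℂ)) x • f x := by
      refine integral_congr_ae ?_
      filter_upwards [hf2.coeFn_toLp] with x hx
      rw [hx, SchwartzMap.fourier_coe]
    have e3 : ∫ x, (𝓕 (G : Space d → ℂ)) x • f x = ∫ x, G x • (𝓕 f) x := by
      simpa using! VectorFourier.integral_fourierIntegral_smul_eq_flip (L := innerₗ (Space d))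
        Real.continuous_fourierChar continuous_inner (G.integrable (μ := volume)) hf
    rw [e2, e3] at e1
    have e4 : ∀ x, G x = (g x : ℂ) := fun x ↦ rfl
    simp only [e4, Complex.coe_smul] at e1
    exact e1.symm
  have h1 : ‖(𝓕 F : L2 (Space d))‖ = ‖F‖ := Lp.norm_fourier_eq F
  rw [Lp.norm_def, Lp.norm_def, ENNReal.toReal_eq_toReal_iff' (Lp.eLpNorm_ne_top _)
    (Lp.eLpNorm_ne_top _), eLpNorm_congr_ae hae, eLpNorm_congr_ae hf2.coeFn_toLp] at h1
  exact h1

lemma eLpNorm_two_sq {α : Type*} [MeasurableSpace α] (μ : Measure α) (f : α → ℂ) :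
    eLpNorm f 2 μ ^ 2 = ∫⁻ a, ‖f a‖ₑ ^ 2 ∂μ := by
  rw [eLpNorm_eq_lintegral_rpow_enorm_toReal (by simp) (by simp), ← ENNReal.rpow_natCast,
    ← ENNReal.rpow_mul]
  simp

/-- Moyal's identity `‖V_φ ψ‖ = ‖φ‖ ‖ψ‖`. -/
lemma eLpNorm_stft (φ ψ : L2 (Space d)) :
    eLpNorm (stft φ ψ) 2 volume = eLpNorm φ 2 volume * eLpNorm ψ 2 volume := by
  have hφm : Measurable fun p : Space d × Space d ↦ ‖φ (p.2 - p.1)‖ₑ ^ 2 :=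
    ((Lp.stronglyMeasurable φ).measurable.comp
      (measurable_snd.sub measurable_fst)).enorm.pow_const 2
  have hψm : Measurable fun p : Space d × Space d ↦ ‖ψ p.2‖ₑ ^ 2 :=
    ((Lp.stronglyMeasurable ψ).measurable.comp measurable_snd).enorm.pow_const 2
  have hprod : ∫⁻ x, ∫⁻ t, ‖ψ t * conj (φ (t - x))‖ₑ ^ 2
      = eLpNorm φ 2 volume ^ 2 * eLpNorm ψ 2 volume ^ 2 := by
    have : ∀ x t, ‖ψ t * conj (φ (t - x))‖ₑ ^ 2 = ‖ψ t‖ₑ ^ 2 * ‖φ (t - x)‖ₑ ^ 2 := by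
      intro x t
      rw [enorm_mul, mul_pow, RCLike.enorm_conj]
    simp only [this]
    rw [lintegral_lintegral_swap (hψm.mul hφm).aemeasurable, eLpNorm_two_sq, eLpNorm_two_sq]
    have h2 : ∀ t, ∫⁻ x, ‖ψ t‖ₑ ^ 2 * ‖φ (t - x)‖ₑ ^ 2
        = ‖ψ t‖ₑ ^ 2 * ∫⁻ x, ‖φ x‖ₑ ^ 2 := by
      intro t
      rw [lintegral_const_mul' _ _ (by finiteness),
        lintegral_sub_left_eq_self (fun x ↦ ‖φ x‖ₑ ^ 2) t]
    simp only [h2]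
    rw [lintegral_mul_const _ ((Lp.stronglyMeasurable ψ).measurable.enorm.pow_const 2), mul_comm]
  have hae : ∀ᵐ x : Space d, ∫⁻ t, ‖ψ t * conj (φ (t - x))‖ₑ ^ 2 < ∞ := by
    refine ae_lt_top' ?_ ?_
    · refine AEMeasurable.lintegral_prod_right' (f := fun p : Space d × Space d ↦
        ‖ψ p.2 * conj (φ (p.2 - p.1))‖ₑ ^ 2) ?_
      have h := (hψm.mul hφm).aemeasurable (μ := volume.prod volume)
      refine h.congr (.of_forall fun p ↦ ?_)
      simp [mul_pow]
    · rw [hprod]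
      have := Lp.eLpNorm_ne_top φ
      have := Lp.eLpNorm_ne_top ψ
      finiteness
  have hsq : eLpNorm (stft φ ψ) 2 volume ^ 2
      = (eLpNorm φ 2 volume * eLpNorm ψ 2 volume) ^ 2 := by
    rw [eLpNorm_two_sq, mul_pow, ← hprod, Measure.volume_eq_prod,
      lintegral_prod _ ((continuous_stft φ ψ).measurable.enorm.pow_const 2).aemeasurable]
    refine lintegral_congr_ae ?_
    filter_upwards [hae] with x hx
    have hint := integrable_stft φ ψ x
    rw [← eLpNorm_two_sq] at hx
    have hmem : MemLp (fun t ↦ ψ t * conj (φ (t - x))) 2 volume :=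
      ⟨hint.1, by
        by_contra hc
        rw [not_lt, top_le_iff] at hc
        simp [hc] at hx⟩
    have := eLpNorm_fourier_eq hint hmem
    simp only [stft_eq_fourier]
    rw [← eLpNorm_two_sq, ← eLpNorm_two_sq, ← this]
  exact (ENNReal.pow_right_strictMono two_ne_zero).injective hsq

lemma memLp_stft (φ ψ : L2 (Space d)) : MemLp (stft φ ψ) 2 volume :=
  ⟨(continuous_stft φ ψ).aestronglyMeasurable, by
    rw [eLpNorm_stft]
    exact ENNReal.mul_lt_top (Lp.eLpNorm_lt_top φ) (Lp.eLpNorm_lt_top ψ)⟩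

/-- The short-time Fourier transform as a bounded operator `V_φ : L²(ℝᵈ) → L²(ℝ²ᵈ)`. -/
def stftCLM (φ : L2 (Space d)) : L2 (Space d) →L[ℂ] L2 (PhaseSpace d) :=
  LinearMap.mkContinuous
    { toFun := fun ψ ↦ (memLp_stft φ ψ).toLp (stft φ ψ)
      map_add' := fun ψ₁ ψ₂ ↦ by
        rw [← MemLp.toLp_add]
        exact MemLp.toLp_congr _ _ (.of_forall fun z ↦ by rw [stft_add])
      map_smul' := fun c ψ ↦ by
        rw [RingHom.id_apply, ← MemLp.toLp_const_smul]
        exact MemLp.toLp_congr _ _ (.of_forall fun z ↦ by rw [stft_smul]) }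
    ‖φ‖ (fun ψ ↦ by
      simp only [LinearMap.coe_mk, AddHom.coe_mk]
      rw [Lp.norm_toLp, eLpNorm_stft, ENNReal.toReal_mul, ← Lp.norm_def, ← Lp.norm_def])

/-! ### Convolution with a bounded measure -/

/-- The convolution `(μ * F)(z) = ∫ F(z - w) dμ(w)` of a function with a bounded complex
measure. -/
def measureConv (μ : ComplexMeasure (PhaseSpace d)) (F : PhaseSpace d → ℂ)
    (z : PhaseSpace d) : ℂ :=
  μ.integral (fun w ↦ F (z - w)) (ContinuousLinearMap.mul ℝ ℂ)

lemma measureConv_smul (μ : ComplexMeasure (PhaseSpace d)) (c : ℂ) (F : PhaseSpace d → ℂ)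
    (z : PhaseSpace d) : measureConv μ (c • F) z = c • measureConv μ F z := by
  rw [measureConv, measureConv, VectorMeasure.integral_eq_setToFun,
    VectorMeasure.integral_eq_setToFun]
  refine setToFun_smul _ (fun c s x ↦ ?_) c (fun w ↦ F (z - w))
  rw [transpose_eq_cbmApplyMeasure, cbmApplyMeasure_apply, cbmApplyMeasure_apply]
  simp [mul_assoc]

lemma isFiniteMeasure_variation {α : Type*} [MeasurableSpace α] (μ : ComplexMeasure α) :
    IsFiniteMeasure μ.variation := by
  have h : μ.variation ≤ (ComplexMeasure.re μ).totalVariation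
      + (ComplexMeasure.im μ).totalVariation := by
    refine VectorMeasure.variation_le_of_forall_enorm_le fun s hs ↦ ?_
    have h1 := (ComplexMeasure.re μ).enorm_le_totalVariation s
    have h2 := (ComplexMeasure.im μ).enorm_le_totalVariation s
    rw [Measure.add_apply]
    refine le_trans ?_ (add_le_add h1 h2)
    have : (μ s) = ((μ s).re : ℂ) + ((μ s).im : ℂ) * Complex.I := (Complex.re_add_im _).symm
    calc ‖μ s‖ₑ = ‖((μ s).re : ℂ) + ((μ s).im : ℂ) * Complex.I‖ₑ := by rw [← this]
      _ ≤ ‖((μ s).re : ℂ)‖ₑ + ‖((μ s).im : ℂ) * Complex.I‖ₑ := enorm_add_le _ _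
      _ = _ := by
        have e1 : ComplexMeasure.re μ s = (μ s).re := rfl
        have e2 : ComplexMeasure.im μ s = (μ s).im := rfl
        rw [e1, e2]
        simp [enorm_eq_nnnorm]
  exact isFiniteMeasure_of_le _ h

lemma integrable_conv (μ : ComplexMeasure (PhaseSpace d)) {F : PhaseSpace d → ℂ}
    (hF : Continuous F) {C : ℝ} (hC : ∀ z, ‖F z‖ ≤ C) (z : PhaseSpace d) :
    μ.Integrable fun w ↦ F (z - w) := by
  have := isFiniteMeasure_variation μ
  exact Integrable.of_bound (C := C) (Continuous.aestronglyMeasurable (by fun_prop))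
    (.of_forall fun w ↦ hC _)

lemma continuous_measureConv (μ : ComplexMeasure (PhaseSpace d)) {F : PhaseSpace d → ℂ}
    (hF : Continuous F) {C : ℝ} (hC : ∀ z, ‖F z‖ ≤ C) : Continuous (measureConv μ F) := by
  have := isFiniteMeasure_variation μ
  exact VectorMeasure.continuous_of_dominated (bound := fun _ ↦ C)
    (fun z ↦ Continuous.aestronglyMeasurable (by fun_prop)) (fun z ↦ .of_forall fun w ↦ hC _)
    (integrable_const C) (.of_forall fun w ↦ by fun_prop)

/-- Young's inequality `‖μ * F‖ ≤ ‖μ‖ ‖F‖`. -/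
lemma eLpNorm_measureConv_le (μ : ComplexMeasure (PhaseSpace d)) {F : PhaseSpace d → ℂ}
    (hF : Continuous F) :
    eLpNorm (measureConv μ F) 2 volume ≤ μ.variation Set.univ * eLpNorm F 2 volume := by
  have := isFiniteMeasure_variation μ
  have hpt : ∀ z, ‖measureConv μ F z‖ₑ ^ 2
      ≤ μ.variation Set.univ * ∫⁻ w, ‖F (z - w)‖ₑ ^ 2 ∂μ.variation := by
    intro z
    have h1 : ‖measureConv μ F z‖ₑ ≤ ∫⁻ w, ‖F (z - w)‖ₑ ∂μ.variation := by
      refine VectorMeasure.enorm_integral_le_lintegral_enorm.trans ?_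
      refine mul_le_of_le_one_left (zero_le) ?_
      rw [← ofReal_norm]
      simp
    have h2 := ENNReal.lintegral_mul_le_Lp_mul_Lq μ.variation Real.HolderConjugate.two_two
      (f := fun _ ↦ 1) (g := fun w ↦ ‖F (z - w)‖ₑ) aemeasurable_const
      (Continuous.aemeasurable (by fun_prop))
    simp only [Pi.mul_apply, one_mul, ENNReal.one_rpow, lintegral_one] at h2
    calc ‖measureConv μ F z‖ₑ ^ 2
        ≤ (μ.variation Set.univ ^ (1 / (2 : ℝ)) *
            (∫⁻ w, ‖F (z - w)‖ₑ ^ (2 : ℝ) ∂μ.variation) ^ (1 / (2 : ℝ))) ^ 2 := by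
          gcongr
          exact h1.trans h2
      _ = _ := by
          rw [mul_pow, ← ENNReal.rpow_natCast, ← ENNReal.rpow_natCast, ← ENNReal.rpow_mul,
            ← ENNReal.rpow_mul]
          simp
  have hsq : eLpNorm (measureConv μ F) 2 volume ^ 2
      ≤ (μ.variation Set.univ * eLpNorm F 2 volume) ^ 2 := by
    rw [eLpNorm_two_sq, mul_pow, eLpNorm_two_sq]
    refine (lintegral_mono hpt).trans ?_
    rw [lintegral_const_mul' _ _ (measure_ne_top _ _), lintegral_lintegral_swap
      (Continuous.aemeasurable (by fun_prop))]
    have hinv : (volume : Measure (PhaseSpace d)).IsAddRightInvariant := by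
      rw [Measure.volume_eq_prod]
      infer_instance
    have : ∀ w : PhaseSpace d, ∫⁻ z, ‖F (z - w)‖ₑ ^ 2 = ∫⁻ z, ‖F z‖ₑ ^ 2 := fun w ↦
      lintegral_sub_right_eq_self (fun z ↦ ‖F z‖ₑ ^ 2) w
    simp only [this, lintegral_const]
    rw [sq, mul_assoc, mul_comm (lintegral _ _)]
  exact (ENNReal.pow_right_strictMono two_ne_zero).le_iff_le.1 hsq

lemma memLp_measureConv_stft (μ : ComplexMeasure (PhaseSpace d)) (φ ψ : L2 (Space d)) :
    MemLp (measureConv μ (stft φ ψ)) 2 volume := by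
  have := isFiniteMeasure_variation μ
  refine ⟨(continuous_measureConv μ (continuous_stft φ ψ)
    (norm_stft_le φ ψ)).aestronglyMeasurable, ?_⟩
  exact (eLpNorm_measureConv_le μ (continuous_stft φ ψ)).trans_lt
    (ENNReal.mul_lt_top (measure_lt_top _ _) (memLp_stft φ ψ).2)

/-- The bounded operator `ψ ↦ μ * V_φ ψ` from `L²(ℝᵈ)` to `L²(ℝ²ᵈ)`. -/
def convStftCLM (μ : ComplexMeasure (PhaseSpace d)) (φ : L2 (Space d)) :
    L2 (Space d) →L[ℂ] L2 (PhaseSpace d) :=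
  LinearMap.mkContinuous
    { toFun := fun ψ ↦ (memLp_measureConv_stft μ φ ψ).toLp (measureConv μ (stft φ ψ))
      map_add' := fun ψ₁ ψ₂ ↦ by
        rw [← MemLp.toLp_add]
        refine MemLp.toLp_congr _ _ (.of_forall fun z ↦ ?_)
        rw [stft_add]
        exact VectorMeasure.integral_fun_add
          (integrable_conv μ (continuous_stft φ ψ₁) (norm_stft_le φ ψ₁) z)
          (integrable_conv μ (continuous_stft φ ψ₂) (norm_stft_le φ ψ₂) z)
      map_smul' := fun c ψ ↦ by
        rw [RingHom.id_apply, ← MemLp.toLp_const_smul]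
        refine MemLp.toLp_congr _ _ (.of_forall fun z ↦ ?_)
        rw [stft_smul]
        exact measureConv_smul μ c _ z }
    ((μ.variation Set.univ).toReal * ‖φ‖) (fun ψ ↦ by
      have := isFiniteMeasure_variation μ
      simp only [LinearMap.coe_mk, AddHom.coe_mk]
      rw [Lp.norm_toLp, Lp.norm_def, Lp.norm_def, mul_assoc, ← ENNReal.toReal_mul,
        ← ENNReal.toReal_mul, ← eLpNorm_stft]
      refine ENNReal.toReal_mono ?_ (eLpNorm_measureConv_le μ (continuous_stft φ ψ))
      exact (ENNReal.mul_lt_top (measure_lt_top _ _) (memLp_stft φ ψ).2).ne)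

/-! ### The blurring operator -/

/-- The time-frequency blurring operator `B_μ^φ ψ = V_φ^* (μ * V_φ ψ)` on `L²(ℝᵈ)`. -/
def blurring (μ : ComplexMeasure (PhaseSpace d)) (φ : L2 (Space d)) :
    L2 (Space d) →L[ℂ] L2 (Space d) :=
  (ContinuousLinearMap.adjoint (stftCLM φ)).comp (convStftCLM μ φ)

/-- Membership in Feichtinger's algebra `M¹(ℝᵈ)`: the short-time Fourier transform with respect
to a nonzero Schwartz window is integrable over phase space. -/
def MemFeichtinger (φ : L2 (Space d)) : Prop :=
  ∃ g : 𝓢(Space d, ℂ), g ≠ 0 ∧ Integrable (stft g φ)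

end TimeFrequency

end

/-! The short-time Fourier transform turns the modulation `M_b ψ(t) = e^{2πi b·t} ψ(t)` into the
translation by `(0, b)` of phase space. Convolution with `μ` commutes with translations, and these
preserve the inner product of `L²(ℝ²ᵈ)`, so the blurring operator `B` satisfies
`⟪M_b η, B M_b ψ⟫ = ⟪η, B ψ⟫` for all `b` (`inner_modulate_blurring`). In particular
`⟪M_b B ψ, B M_b ψ⟫ = ‖B ψ‖²`.

If `B` were compact, the bounded family `M_b ψ` would have images `B M_b ψ` converging in norm to
some `g` along an ultrafilter finer than `|b| → ∞`, which exists because `d ≥ 1`. By the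
Riemann–Lebesgue lemma modulations tend weakly to zero (`tendsto_inner_modulate`), hence
`⟪M_b B ψ, g⟫ → 0`; since `‖M_b B ψ‖ = ‖B ψ‖` is bounded, also `⟪M_b B ψ, B M_b ψ⟫ → 0`, and
`B ψ = 0`. -/

open MeasureTheory FourierTransform SchwartzMap Filter
open scoped ENNReal ComplexConjugate RealInnerProductSpace Topology

noncomputable section

namespace TimeFrequency

variable {d : ℕ}

/-! ### Modulations -/

lemma norm_modulation_phase (b t : Space d) :
    ‖Complex.exp (2 * Real.pi * Complex.I * ((⟪b, t⟫ : ℝ) : ℂ))‖ = 1 := by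
  rw [Complex.norm_exp]
  simp

lemma memLp_modulation (b : Space d) (f : L2 (Space d)) :
    MemLp (fun t ↦ Complex.exp (2 * Real.pi * Complex.I * ((⟪b, t⟫ : ℝ) : ℂ)) * f t) 2 volume := by
  refine (Lp.memLp f).of_le ?_ (.of_forall fun t ↦ ?_)
  · exact (Continuous.aestronglyMeasurable (by fun_prop)).mul (Lp.aestronglyMeasurable f)
  · rw [norm_mul, norm_modulation_phase, one_mul]

/-- The modulation `M_b f(t) = e^{2πi b·t} f(t)` of `f ∈ L²(ℝᵈ)`. -/
def modulate (b : Space d) (f : L2 (Space d)) : L2 (Space d) :=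
  (memLp_modulation b f).toLp _

lemma coeFn_modulate (b : Space d) (f : L2 (Space d)) :
    modulate b f =ᵐ[volume]
      fun t ↦ Complex.exp (2 * Real.pi * Complex.I * ((⟪b, t⟫ : ℝ) : ℂ)) * f t :=
  (memLp_modulation b f).coeFn_toLp

lemma norm_modulate (b : Space d) (f : L2 (Space d)) : ‖modulate b f‖ = ‖f‖ := by
  rw [Lp.norm_def, Lp.norm_def]
  congr 1
  refine eLpNorm_congr_norm_ae ?_
  filter_upwards [coeFn_modulate b f] with t ht
  rw [ht, norm_mul, norm_modulation_phase, one_mul]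

/-- Modulations tend weakly to zero at infinity: the matrix coefficients of `M_b` are values of the
Fourier transform of an integrable function. -/
lemma tendsto_inner_modulate (f g : L2 (Space d)) :
    Tendsto (fun b ↦ inner ℂ (modulate b f) g) (cocompact (Space d)) (𝓝 0) := by
  refine (tendsto_integral_exp_inner_smul_cocompact (fun t ↦ g t * conj (f t))).congr fun b ↦ ?_
  rw [L2.inner_def]
  refine integral_congr_ae ?_
  filter_upwards [coeFn_modulate b f] with t ht
  rw [ht, RCLike.inner_apply, map_mul, ← Complex.exp_conj, Circle.smul_def,
    Real.fourierChar_apply, smul_eq_mul, real_inner_comm b t]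
  simp only [map_mul, Complex.conj_ofReal, Complex.conj_I, map_ofNat]
  rw [mul_left_comm]
  congr 2
  push_cast
  ring_nf

/-! ### Covariance -/

/-- Covariance of the short-time Fourier transform under modulations. -/
lemma stft_modulate (φ f : L2 (Space d)) (b : Space d) (z : PhaseSpace d) :
    stft φ (modulate b f) z = stft φ f (z - (0, b)) := by
  refine integral_congr_ae ?_
  filter_upwards [coeFn_modulate b f] with t ht
  rw [ht, Prod.fst_sub, Prod.snd_sub, sub_zero, inner_sub_left]
  rw [mul_assoc (Complex.exp _), mul_comm (Complex.exp _), mul_assoc, ← Complex.exp_add]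
  congr 2
  push_cast
  ring

lemma measureConv_stft_modulate (μ : ComplexMeasure (PhaseSpace d)) (φ f : L2 (Space d))
    (b : Space d) (z : PhaseSpace d) :
    measureConv μ (stft φ (modulate b f)) z = measureConv μ (stft φ f) (z - (0, b)) := by
  simp only [measureConv, stft_modulate, sub_right_comm]

lemma inner_blurring (μ : ComplexMeasure (PhaseSpace d)) (φ f g : L2 (Space d)) :
    inner ℂ g (blurring μ φ f) =
      ∫ z, inner ℂ (stft φ g z) (measureConv μ (stft φ f) z) := by
  rw [blurring, ContinuousLinearMap.comp_apply, ContinuousLinearMap.adjoint_inner_right,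
    L2.inner_def]
  refine integral_congr_ae ?_
  filter_upwards [(memLp_stft φ g).coeFn_toLp, (memLp_measureConv_stft μ φ f).coeFn_toLp]
    with z h1 h2
  exact congrArg₂ (inner ℂ) h1 h2

/-- The blurring operator commutes with modulations, stated for its matrix coefficients. -/
lemma inner_modulate_blurring (μ : ComplexMeasure (PhaseSpace d)) (φ f g : L2 (Space d))
    (b : Space d) :
    inner ℂ (modulate b g) (blurring μ φ (modulate b f)) = inner ℂ g (blurring μ φ f) := by
  have : (volume : Measure (PhaseSpace d)).IsAddRightInvariant := by
    rw [Measure.volume_eq_prod]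
    infer_instance
  simp only [inner_blurring, stft_modulate, measureConv_stft_modulate]
  exact integral_sub_right_eq_self
    (fun z ↦ inner ℂ (stft φ g z) (measureConv μ (stft φ f) z)) ((0, b) : PhaseSpace d)

/-! ### Compactness -/

lemma blurring_apply_eq_zero_of_isCompactOperator (hd : 1 ≤ d)
    {μ : ComplexMeasure (PhaseSpace d)} {φ : L2 (Space d)}
    (hc : IsCompactOperator (blurring μ φ)) (f : L2 (Space d)) : blurring μ φ f = 0 := by
  have : Nonempty (Fin d) := ⟨⟨0, hd⟩⟩
  have : NoncompactSpace (Space d) := NormedSpace.noncompactSpace ℝ _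
  set h := blurring μ φ f
  obtain ⟨K, hK, hsub⟩ := IsCompactOperator.image_closedBall_subset_compact
    (f := (blurring μ φ : L2 (Space d) →ₗ[ℂ] L2 (Space d))) hc ‖f‖
  let U : Ultrafilter (Space d) := .of (cocompact (Space d))
  have hU : (U : Filter (Space d)) ≤ cocompact (Space d) := Ultrafilter.of_le _
  have hmem : ∀ b, blurring μ φ (modulate b f) ∈ K := fun b ↦
    hsub ⟨modulate b f, by simp [norm_modulate], rfl⟩
  obtain ⟨g, -, hg⟩ := hK.ultrafilter_le_nhds (U.map fun b ↦ blurring μ φ (modulate b f))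
    (le_principal_iff.2 (Ultrafilter.mem_map.2 (univ_mem' hmem)))
  have h1 : Tendsto (fun b ↦ inner ℂ (modulate b h) g) U (𝓝 0) :=
    (tendsto_inner_modulate h g).mono_left hU
  -- Norm convergence to `g` and boundedness of `M_b h` reduce the limit of `⟪M_b h, B M_b f⟫` to `h1`.
  have h2 : Tendsto (fun b ↦ inner ℂ (modulate b h) (blurring μ φ (modulate b f) - g)) U
      (𝓝 0) := by
    have h3 : Tendsto (fun b ↦ ‖h‖ * ‖blurring μ φ (modulate b f) - g‖) U (𝓝 0) := by
      have h4 : Tendsto (fun b ↦ blurring μ φ (modulate b f)) U (𝓝 g) := hg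
      simpa using (tendsto_iff_norm_sub_tendsto_zero.1 h4).const_mul ‖h‖
    refine squeeze_zero_norm (fun b ↦ ?_) h3
    simpa only [norm_modulate] using
      norm_inner_le_norm (𝕜 := ℂ) (modulate b h) (blurring μ φ (modulate b f) - g)
  have h5 : Tendsto (fun _ : Space d ↦ inner ℂ h h) U (𝓝 0) := by
    refine (zero_add (0 : ℂ) ▸ h1.add h2).congr fun b ↦ ?_
    rw [← inner_add_right, add_sub_cancel, inner_modulate_blurring]
  exact inner_self_eq_zero.1 (tendsto_nhds_unique tendsto_const_nhds h5)

end TimeFrequency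

end

theorem mainTheorem1 (d : ℕ) (hd : 1 ≤ d)
    (μ : MeasureTheory.ComplexMeasure (TimeFrequency.PhaseSpace d))
    (φ : TimeFrequency.L2 (TimeFrequency.Space d)) (hφ : TimeFrequency.MemFeichtinger φ)
    (hB : TimeFrequency.blurring μ φ ≠ 0) :
    ¬ IsCompactOperator (TimeFrequency.blurring μ φ) := fun hc ↦
  hB (ContinuousLinearMap.ext
    (TimeFrequency.blurring_apply_eq_zero_of_isCompactOperator hd hc))
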